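/- **Definitions.** Let $V\subseteq\mathbb R^3$ be open, let $Y$ be a smooth vector field on $V$, let $\operatorname{dist}$ be the Euclidean distance, and let $\Gamma=\gamma(\mathbb R)\subseteq V$ be a periodic orbit of $\dot u=Y(u)$, i.e. $\gamma:\mathbb R\to V$ is a nonconstant solution with $\gamma(t+T)=\gamma(t)$ for all $t$, for some $T>0$. For $x_0\in V$ let $x(\cdot\,;x_0)$ be the solution in $V$ with $x(0;x_0)=x_0$. Let $S\subseteq V$ with $\Gamma\subseteq S$. With respect to perturbations in $S$, the orbit $\Gamma$ is called - *orbitally stable* if for every $\varepsilon>0$ there is $\delta>0$ such that for all $x_0\in S$ with $\operatorname{dist}(x_0,\Gamma)<\delta$ the solution $x(t;x_0)$ exists for all $t\ge 0$ and $\operatorname{dist}(x(t;x_0),\Gamma)<\varepsilon$ for all $t>0$; and *unstable* if it is not orbitally stable; - *orbitally asymptotically stable* if it is orbitally stable and there is $\delta>0$ such that $\operatorname{dist}(x(t;x_0),\Gamma)\to0$ as $t\to\infty$ for all $x_0\in S$ with $\operatorname{dist}(x_0,\Gamma)<\delta$; - *orbitally phase asymptotically stable* if it is orbitally asymptotically stable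 and there is $\delta>0$ such that for every $x_0\in S$ with $\operatorname{dist}(x_0,\Gamma)<\delta$ there is $\theta_0\in\mathbb R$ with $\lim_{t\to\infty}\operatorname{dist}(x(t;x_0),\gamma(t+\theta_0))=0$. **Theorem.** Let $V\subseteq U\subseteq\mathbb R^3$ be open sets and let $H,C,\nu\in C^\infty(U,\mathbb R)$ be such that $H$ and $C$ are functionally independent on $V$, i.e. $\nabla H(u),\nabla C(u)$ are linearly independent for every $u\in V$. Let $\Gamma\subset V$ be a periodic orbit of $$\dot u=\nu(u)\,(\nabla H(u)\times\nabla C(u)),\qquad u\in U, \tag{$*$}$$ and suppose that $\Gamma\subseteq(H,C)^{-1}(\{(h,c)\})$, where $(h,c)\in\mathbb R^2$ is a regular value of $(H,C):U\to\mathbb R^2$. Then the following hold. 1. Suppose that $c$ is a regular value of $C:U\to\mathbb R$. Then for every $\alpha\in C^\infty(V,(0,\infty))$ and each choice of sign, $\Gamma$ is a periodic orbit (with the same parametrization $\gamma$) of $$\dot u=\nu\,(\nabla H\times\nabla C)\mp\alpha\,(H-h)\,[\nabla C\times(\nabla H\times\nabla C)],\qquad u\in V,$$ the function $C$ is a first integral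 of this system (its derivative along the vector field vanishes on $V$), and $V\cap C^{-1}(\{c\})$ is dynamically invariant. Moreover: (a) for the sign $-$, $\Gamma$ is orbitally phase asymptotically stable with respect to perturbations in $V\cap C^{-1}(\{c\})$; (b) for the sign $+$, $\Gamma$ is unstable with respect to perturbations in $V$, and also with respect to perturbations in $V\cap C^{-1}(\{c\})$. 2. For all $\alpha,\beta\in C^\infty(V,(0,\infty))$: (a) $\Gamma$ is a periodic orbit (with the same parametrization $\gamma$) of $$\dot u=\nu\,(\nabla H\times\nabla C)-\alpha\,(H-h)\,[\nabla C\times(\nabla H\times\nabla C)]+\beta\,(C-c)\,[\nabla H\times(\nabla H\times\nabla C)],\qquad u\in V,$$ and it is orbitally phase asymptotically stable with respect to perturbations in $V$; (b) $\Gamma$ is a periodic orbit (with the same parametrization $\gamma$), unstable with respect to perturbations in $V$, of each of the three systems obtained from the one in (a) by changing the sign in front of $\alpha$, or in front of $\beta$, or both. -/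

import Mathlib

open Set Filter Topology
open scoped ContDiff Gradient

namespace Stab3D

/-- Euclidean three-dimensional space. -/
abbrev E3 : Type := EuclideanSpace ℝ (Fin 3)

/-- The vector product on Euclidean three-dimensional space. -/
def cross (u v : E3) : E3 := WithLp.toLp 2 (crossProduct u.ofLp v.ofLp)

/-- `x` solves `x' = Y x` on the time set `J` and stays in `V` there
(one-sided derivatives at the end points of `J` that belong to `J`). -/
def IsSolutionOn (Y : E3 → E3) (V : Set E3) (x : ℝ → E3) (J : Set ℝ) : Prop :=
  IsIntegralCurveOn x (fun _ => Y) J ∧ ∀ t ∈ J, x t ∈ V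

/-- `γ` is a nonconstant periodic solution in `V`, with (not necessarily minimal) period `T > 0`,
of `x' = Y x`. The periodic orbit itself is `Set.range γ`. -/
structure IsPeriodicOrbit (Y : E3 → E3) (V : Set E3) (γ : ℝ → E3) (T : ℝ) : Prop where
  period_pos : 0 < T
  solution : IsSolutionOn Y V γ univ
  periodic : Function.Periodic γ T
  nonconstant : ∃ t, γ t ≠ γ 0

/-- Orbital stability of the orbit `range γ` of `x' = Y x`, `x ∈ V`, with respect to initial
conditions in `S ⊆ V`: the solution starting close to the orbit exists for all positive times and
remains close to the orbit. (The fields considered are smooth on the open set `V`, so the solution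
with given initial value is unique.) -/
def OrbitallyStable (Y : E3 → E3) (V S : Set E3) (γ : ℝ → E3) : Prop :=
  ∀ ε > 0, ∃ δ > 0, ∀ x₀ ∈ S, Metric.infDist x₀ (range γ) < δ →
    ∃ x : ℝ → E3, IsSolutionOn Y V x (Ici 0) ∧ x 0 = x₀ ∧
      ∀ t > 0, Metric.infDist (x t) (range γ) < ε

/-- A periodic orbit is unstable if it is not orbitally stable. -/
def OrbitallyUnstable (Y : E3 → E3) (V S : Set E3) (γ : ℝ → E3) : Prop :=
  ¬ OrbitallyStable Y V S γ

/-- Orbital stability together with attraction of nearby solutions by the orbit. -/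
def OrbitallyAsymptoticallyStable (Y : E3 → E3) (V S : Set E3) (γ : ℝ → E3) : Prop :=
  OrbitallyStable Y V S γ ∧
    ∃ δ > 0, ∀ x₀ ∈ S, Metric.infDist x₀ (range γ) < δ →
      ∃ x : ℝ → E3, IsSolutionOn Y V x (Ici 0) ∧ x 0 = x₀ ∧
        Tendsto (fun t => Metric.infDist (x t) (range γ)) atTop (𝓝 0)

/-- Orbital asymptotic stability together with an asymptotic phase for nearby solutions. -/
def OrbitallyPhaseAsymptoticallyStable (Y : E3 → E3) (V S : Set E3) (γ : ℝ → E3) : Prop :=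
  OrbitallyAsymptoticallyStable Y V S γ ∧
    ∃ δ > 0, ∀ x₀ ∈ S, Metric.infDist x₀ (range γ) < δ →
      ∃ θ₀ : ℝ, ∃ x : ℝ → E3, IsSolutionOn Y V x (Ici 0) ∧ x 0 = x₀ ∧
        Tendsto (fun t => dist (x t) (γ (t + θ₀))) atTop (𝓝 0)

/-- `C` is a first integral of `x' = Y x`, `x ∈ V`: its derivative along `Y` vanishes on `V`. -/
def IsFirstIntegral (Y : E3 → E3) (V : Set E3) (C : E3 → ℝ) : Prop :=
  ∀ u ∈ V, fderiv ℝ C u (Y u) = 0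

/-- `M` is dynamically invariant for `x' = Y x`, `x ∈ V`: a solution on a time interval that is in
`M` at one time is in `M` at all times. -/
def IsInvariantSet (Y : E3 → E3) (V M : Set E3) : Prop :=
  ∀ (x : ℝ → E3) (J : Set ℝ), J.OrdConnected → IsSolutionOn Y V x J →
    ∀ t₀ ∈ J, x t₀ ∈ M → ∀ t ∈ J, x t ∈ M

/-- `y` is a regular value of the restriction of `F` to the open set `U`. -/
def IsRegularValue {G : Type*} [NormedAddCommGroup G] [NormedSpace ℝ G]
    (F : E3 → G) (U : Set E3) (y : G) : Prop :=
  ∀ u ∈ U, F u = y → Function.Surjective (fderiv ℝ F u)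

/-- `H` and `C` are functionally independent on the open set `V`. -/
def FunctionallyIndependentOn (H C : E3 → ℝ) (V : Set E3) : Prop :=
  ∀ u ∈ V, LinearIndependent ℝ ![∇ H u, ∇ C u]

/-- The Hamiltonian vector field `ν (∇H × ∇C)`. -/
noncomputable def hamField (ν H C : E3 → ℝ) : E3 → E3 :=
  fun u => ν u • cross (∇ H u) (∇ C u)

/-- The vector field `α (H - h) [∇C × (∇H × ∇C)]`. -/
noncomputable def hTerm (H C : E3 → ℝ) (h : ℝ) (α : E3 → ℝ) : E3 → E3 :=
  fun u => (α u * (H u - h)) • cross (∇ C u) (cross (∇ H u) (∇ C u))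

/-- The vector field `β (C - c) [∇H × (∇H × ∇C)]`. -/
noncomputable def cTerm (H C : E3 → ℝ) (c : ℝ) (β : E3 → ℝ) : E3 → E3 :=
  fun u => (β u * (C u - c)) • cross (∇ H u) (cross (∇ H u) (∇ C u))

/-- `α` is a smooth function from the open set `V` to `(0, ∞)`. -/
def IsSmoothPos (V : Set E3) (α : E3 → ℝ) : Prop :=
  ContDiffOn ℝ ∞ α V ∧ ∀ u ∈ V, 0 < α u

end Stab3D

open Stab3D

/-!
Write `n = ∇H × ∇C`. The perturbation terms are chosen so that along solutions of
`u' = ν n - α (H - h) [∇C × n] + β (C - c) [∇H × n]` the two functions decouple,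
`(H - h)' = -α ‖n‖² (H - h)` and `(C - c)' = -β ‖n‖² (C - c)`
(`fderiv_left_perturbedField`, `fderiv_right_perturbedField`). On a compact neighbourhood of the
orbit the factors `α ‖n‖²` and `β ‖n‖²` are bounded away from zero, so each defect decays or grows
exponentially according to the sign of its coefficient. The perturbations vanish on the orbit,
which therefore remains a solution.

Instability (`IsPeriodicOrbit.orbitallyUnstable`): as `(h, c)` is a regular value, there are initial
conditions arbitrarily close to the orbit with `H ≠ h` and `C = c`, or with `C ≠ c`; a growing
defect is incompatible with its boundedness near the orbit.

Stability with asymptotic phase (`tendsto_dist_integralCurve_of_exp_decay`): near the orbit, the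
orbit is the whole level set of `(H, C)`, with the linear error bound
`dist u (γ s') ≤ K ‖(H u, C u) - (h, c)‖` for a parameter `s'` that is close to `s` when `u` is
close to `γ s` (`exists_forall_near_hamiltonianOrbit`, an application of the inverse function
theorem in the coordinates `H`, `C`, `⟪n, ·⟫`). At each integer time a solution is compared with
such a point `γ (σ n)`. Grönwall's inequality carries the comparison to time `n + 1`, where the error
bound gives the next point, at the parameter `σ n + 1` up to a multiple of the exponentially small
defect. So the solution stays in the neighbourhood where the defect decays, and `σ n - n` converges
geometrically to the asymptotic phase. To have global solutions and a global Lipschitz constant, the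
field is first cut off away from the orbit
(`exists_lipschitzWith_bounded_eqOn_thickening`).
-/

/-! ### Globally Lipschitz vector fields -/

/-- A bounded and globally Lipschitz vector field has a global integral curve through every
point. -/
theorem exists_isIntegralCurve_of_lipschitzWith_of_bounded {E : Type*} [NormedAddCommGroup E]
    [NormedSpace ℝ E] [CompleteSpace E] {Y : E → E} {K L : NNReal} (hK : LipschitzWith K Y)
    (hL : ∀ u, ‖Y u‖ ≤ L) (x₀ : E) :
    ∃ x : ℝ → E, x 0 = x₀ ∧ IsIntegralCurve x (fun _ => Y) := by
  have hex : ∀ n : ℕ, ∃ x : ℝ → E, x 0 = x₀ ∧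
      ∀ t ∈ Ioo (-((n : ℝ) + 1)) (n + 1), HasDerivAt x (Y (x t)) t := by
    intro n
    have hn : (0 : ℝ) < n + 1 := by positivity
    have hpl : IsPicardLindelof (fun _ : ℝ => Y) (tmin := -((n : ℝ) + 1)) (tmax := n + 1)
        ⟨0, by constructor <;> linarith⟩ x₀ (L * (n + 1)) 0 L K := by
      refine ⟨fun t _ => hK.lipschitzOnWith, fun u _ => continuousOn_const, fun t _ u _ => hL u, ?_⟩
      simp
    obtain ⟨x, hx0, hx⟩ := hpl.exists_eq_forall_mem_Icc_hasDerivWithinAt₀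
    exact ⟨x, hx0, fun t ht => (hx t (Ioo_subset_Icc_self ht)).hasDerivAt
      (Icc_mem_nhds ht.1 ht.2)⟩
  choose x hx0 hx using hex
  have huniq : ∀ m n : ℕ, m ≤ n → ∀ t ∈ Ioo (-((m : ℝ) + 1)) (m + 1), x n t = x m t := by
    intro m n hmn t ht
    have hmn' : (m : ℝ) ≤ n := by exact_mod_cast hmn
    have hm : (0 : ℝ) < m + 1 := by positivity
    refine ODE_solution_unique_of_mem_Ioo (v := fun _ => Y) (s := fun _ => univ) (K := K)
      (a := -((m : ℝ) + 1)) (b := m + 1) (t₀ := 0)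
      (fun _ _ => hK.lipschitzOnWith) ⟨by linarith, hm⟩
      (fun r hr => ⟨hx n r ⟨by linarith [hr.1], by linarith [hr.2]⟩, mem_univ _⟩)
      (fun r hr => ⟨hx m r hr, mem_univ _⟩) (by rw [hx0, hx0]) ht
  -- the solution on `(-n - 1, n + 1)` is used at the times whose absolute value has ceiling `n`
  refine ⟨fun t => x ⌈|t|⌉₊ t, by simp [hx0], fun t => ?_⟩
  set N := ⌈|t|⌉₊ + 1 with hN
  have hlt : |t| < N := by
    have := Nat.le_ceil |t|
    push_cast [hN]; linarith
  have hev : (fun t => x ⌈|t|⌉₊ t) =ᶠ[𝓝 t] x N := by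
    have : ∀ᶠ r : ℝ in 𝓝 t, |r| < N := continuous_abs.continuousAt.eventually_lt_const hlt
    filter_upwards [this] with r hr
    refine (huniq _ N (Nat.ceil_le.2 hr.le) r ?_).symm
    have := Nat.le_ceil |r|
    exact abs_lt.1 (by linarith)
  have hval : x ⌈|t|⌉₊ t = x N t := hev.self_of_nhds
  refine HasDerivAt.congr_of_eventuallyEq ?_ hev
  change HasDerivAt (x N) (Y (x ⌈|t|⌉₊ t)) t
  rw [hval]
  exact hx N t (abs_lt.1 (by linarith))

/-- Grönwall's inequality for two integral curves, which may be followed from different starting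
times because the field is autonomous. -/
theorem dist_integralCurve_add_le {E : Type*} [NormedAddCommGroup E] [NormedSpace ℝ E]
    {Y : E → E} {K : NNReal} (hK : LipschitzWith K Y) {x y : ℝ → E}
    (hx : IsIntegralCurve x (fun _ => Y)) (hy : IsIntegralCurve y (fun _ => Y)) (a b : ℝ) {r : ℝ}
    (hr : 0 ≤ r) : dist (x (a + r)) (y (b + r)) ≤ dist (x a) (y b) * Real.exp (K * r) := by
  have hx' : ∀ t, HasDerivAt (fun s => x (a + s)) (Y (x (a + t))) t := fun t =>
    (hx (a + t)).comp_const_add a t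
  have hy' : ∀ t, HasDerivAt (fun s => y (b + s)) (Y (y (b + t))) t := fun t =>
    (hy (b + t)).comp_const_add b t
  have := dist_le_of_trajectories_ODE (v := fun _ => Y) (K := K) (a := 0) (b := r)
    (f := fun s => x (a + s)) (g := fun s => y (b + s)) (δ := dist (x a) (y b)) (fun _ => hK)
    (fun t _ => (hx' t).continuousAt.continuousWithinAt) (fun t _ => (hx' t).hasDerivWithinAt)
    (fun t _ => (hy' t).continuousAt.continuousWithinAt) (fun t _ => (hy' t).hasDerivWithinAt)
    (by simp) r ⟨hr, le_rfl⟩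
  simpa using this

/-- A `C¹` vector field on an open set can be modified away from a compact set so that it becomes
bounded and globally Lipschitz. -/
theorem exists_lipschitzWith_bounded_eqOn_thickening {E : Type*} [NormedAddCommGroup E]
    [NormedSpace ℝ E] [FiniteDimensional ℝ E] {V Γ : Set E} (hV : IsOpen V) (hΓ : IsCompact Γ)
    (hΓV : Γ ⊆ V) {Y : E → E} (hY : ContDiffOn ℝ 1 Y V) :
    ∃ (Z : E → E) (K L : NNReal), LipschitzWith K Z ∧ (∀ u, ‖Z u‖ ≤ L) ∧
      ∃ ε > 0, ∀ u ∈ Metric.thickening ε Γ, u ∈ V ∧ Z u = Y u := by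
  have : ProperSpace E := FiniteDimensional.proper ℝ E
  obtain ⟨ε, hε, hεV⟩ := hΓ.exists_cthickening_subset_open hV hΓV
  have hcomp : IsCompact (Metric.cthickening ε Γ) := hΓ.cthickening
  obtain ⟨χ, hχ1, hχ0, -⟩ := exists_contMDiffMap_one_nhds_of_subset_interior
    (modelWithCornersSelf ℝ E) (n := 1) hΓ.isClosed
    ((Metric.self_subset_thickening hε Γ).trans (Metric.thickening_subset_interior_cthickening ε Γ))
  have hχ : ContDiff ℝ 1 χ := χ.contMDiff.contDiff
  have htsupp : tsupport (fun u => χ u • Y u) ⊆ Metric.cthickening ε Γ := by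
    refine closure_minimal (fun u hu => ?_) Metric.isClosed_cthickening
    by_contra hu'
    exact hu (by simp [hχ0 u hu'])
  have hZs : HasCompactSupport (fun u => χ u • Y u) :=
    hcomp.of_isClosed_subset (isClosed_tsupport _) htsupp
  have hZ : ContDiff ℝ 1 (fun u => χ u • Y u) := by
    refine contDiff_iff_contDiffAt.2 fun u => ?_
    by_cases hu : u ∈ tsupport (fun u => χ u • Y u)
    · exact hχ.contDiffAt.smul (hY.contDiffAt (hV.mem_nhds (hεV (htsupp hu))))
    · exact contDiffAt_const.congr_of_eventuallyEq (notMem_tsupport_iff_eventuallyEq.1 hu)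
  obtain ⟨K, hK⟩ := hZ.lipschitzWith_of_hasCompactSupport hZs one_ne_zero
  obtain ⟨L, hL⟩ := hZs.exists_bound_of_continuous hZ.continuous
  obtain ⟨O, hO, hΓO, hO1⟩ := eventually_nhdsSet_iff_exists.1 hχ1
  obtain ⟨ε', hε', hεO⟩ := hΓ.exists_thickening_subset_open (hO.inter hV) (subset_inter hΓO hΓV)
  refine ⟨_, K, L.toNNReal, hK, fun u => (hL u).trans (Real.le_coe_toNNReal L), ε', hε',
    fun u hu => ⟨(hεO hu).2, ?_⟩⟩
  simp [hO1 u (hεO hu).1]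

/-! ### Level curves with transversal coordinates -/

/-- Let `γ` lie in the level set `g = z`, and let `g` together with a linear form `l` that is
nonconstant along `γ` be an immersion at `γ t₀`. Then `γ` fills the level set near `γ t₀`, with a
linear error bound: a point `u` near `γ s` is at distance `O(‖g u - z‖)` of a point `γ s'` whose
parameter is `O(dist u (γ s))`-close to `s`. The point `γ s'` is the one at which `l` takes the
value `l u`. -/
theorem eventually_exists_near_levelCurve {E F : Type*} [NormedAddCommGroup E]
    [NormedSpace ℝ E] [FiniteDimensional ℝ E] [NormedAddCommGroup F] [NormedSpace ℝ F]
    {g : E → F} {g' : E →L[ℝ] F} {l : E →L[ℝ] ℝ} {γ : ℝ → E} {w : E} {t₀ : ℝ} {z : F}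
    (hg : HasStrictFDerivAt g g' (γ t₀)) (hγ : HasStrictDerivAt γ w t₀) (hw : l w ≠ 0)
    (hinj : ∀ v, g' v = 0 → l v = 0 → v = 0) (hz : ∀ t, g (γ t) = z) :
    ∃ K : ℝ, ∀ᶠ p : ℝ × E in 𝓝 t₀ ×ˢ 𝓝 (γ t₀), ∃ s',
      |s' - p.1| ≤ K * dist p.2 (γ p.1) ∧ dist p.2 (γ s') ≤ K * ‖g p.2 - z‖ := by
  have hq : HasStrictDerivAt (fun t => l (γ t)) (l w) t₀ :=
    l.hasStrictFDerivAt.comp_hasStrictDerivAt t₀ hγ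
  set inv := hq.localInverse (fun t => l (γ t)) (l w) t₀ hw with hinv
  have hinvd : HasStrictDerivAt inv (l w)⁻¹ (l (γ t₀)) := hq.to_localInverse hw
  have hleft : ∀ᶠ t in 𝓝 t₀, inv (l (γ t)) = t := hq.eventually_left_inverse hw
  have hright : ∀ᶠ y in 𝓝 (l (γ t₀)), l (γ (inv y)) = y := hq.eventually_right_inverse hw
  obtain ⟨K₁, A, hA, hlip⟩ := hinvd.hasStrictFDerivAt.exists_lipschitzOnWith
  -- `g` together with `l` is antilipschitz near `γ t₀`
  have hΦ : HasStrictFDerivAt (fun u => (g u, l u)) (g'.prod l) (γ t₀) :=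
    hg.prodMk l.hasStrictFDerivAt
  obtain ⟨K₀, hK₀, hanti⟩ := LinearMap.exists_antilipschitzWith ((g'.prod l : E →L[ℝ] F × ℝ) :
    E →ₗ[ℝ] F × ℝ) (by
      rw [LinearMap.ker_eq_bot']
      intro v hv
      have hv' : (g' v, l v) = (0, 0) := hv
      exact hinj v (Prod.ext_iff.1 hv').1 (Prod.ext_iff.1 hv').2)
  have hK₀' : (0 : ℝ) < K₀ := by exact_mod_cast hK₀
  have hloc : ∀ᶠ p : E × E in 𝓝 (γ t₀, γ t₀),
      dist p.1 p.2 ≤ 2 * K₀ * ‖(g p.1, l p.1) - (g p.2, l p.2)‖ := by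
    have h1 := hΦ.isLittleO.def (c := (2 * K₀ : ℝ)⁻¹) (by positivity)
    filter_upwards [h1] with p hp
    have h2 : ‖p.1 - p.2‖ ≤ K₀ * ‖(g'.prod l) (p.1 - p.2)‖ := by
      have := hanti.le_mul_dist p.1 p.2
      rw [dist_eq_norm, dist_eq_norm, ← map_sub] at this
      exact this
    have h3 : ‖(g'.prod l) (p.1 - p.2)‖ ≤ ‖(g p.1, l p.1) - (g p.2, l p.2)‖
        + (2 * K₀ : ℝ)⁻¹ * ‖p.1 - p.2‖ := by
      refine le_trans ?_ (add_le_add_right hp _)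
      rw [norm_sub_rev ((g p.1, l p.1) - (g p.2, l p.2))]
      exact norm_le_insert' _ _
    rw [dist_eq_norm]
    have h4 : K₀ * ((2 * K₀ : ℝ)⁻¹ * ‖p.1 - p.2‖) = ‖p.1 - p.2‖ / 2 := by field_simp
    nlinarith [mul_le_mul_of_nonneg_left h3 hK₀'.le]
  have hlc : Tendsto l (𝓝 (γ t₀)) (𝓝 (l (γ t₀))) := l.continuous.continuousAt
  have hinv0 : inv (l (γ t₀)) = t₀ := hleft.self_of_nhds
  have hγinv : Tendsto (fun u => γ (inv (l u))) (𝓝 (γ t₀)) (𝓝 (γ t₀)) := by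
    have h1 : Tendsto inv (𝓝 (l (γ t₀))) (𝓝 t₀) := by
      have := hinvd.hasDerivAt.continuousAt.tendsto
      rwa [hinv0] at this
    exact hγ.hasDerivAt.continuousAt.tendsto.comp (h1.comp hlc)
  have hpair : ∀ᶠ u in 𝓝 (γ t₀),
      dist u (γ (inv (l u))) ≤ 2 * K₀ * ‖(g u, l u) - (g (γ (inv (l u))), l (γ (inv (l u))))‖ :=
    (tendsto_id.prodMk_nhds hγinv).eventually hloc
  have hγc : Tendsto (fun t => l (γ t)) (𝓝 t₀) (𝓝 (l (γ t₀))) := hq.hasDerivAt.continuousAt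
  refine ⟨max (K₁ * ‖l‖) (2 * K₀), ?_⟩
  have hS := hleft.and (hγc.eventually hA)
  have hU := (hpair.and (hlc.eventually hA)).and (hlc.eventually hright)
  filter_upwards [hS.prod_mk hU] with p hp
  obtain ⟨⟨hl1, hs⟩, ⟨hp1, hu⟩, hr1⟩ := hp
  refine ⟨inv (l p.2), ?_, ?_⟩
  · have h1 := hlip.dist_le_mul _ hu _ hs
    rw [hl1, Real.dist_eq, Real.dist_eq, ← map_sub] at h1
    have h2 := l.le_opNorm (p.2 - γ p.1)
    rw [Real.norm_eq_abs, ← dist_eq_norm] at h2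
    calc _ ≤ _ := h1
      _ ≤ K₁ * (‖l‖ * dist p.2 (γ p.1)) := by gcongr
      _ = (K₁ * ‖l‖) * dist p.2 (γ p.1) := by ring
      _ ≤ _ := by gcongr; exact le_max_left _ _
  · have h1 : ‖(g p.2, l p.2) - (g (γ (inv (l p.2))), l (γ (inv (l p.2))))‖ = ‖g p.2 - z‖ := by
      rw [hr1, hz]
      simp [Prod.norm_def]
    rw [h1] at hp1
    refine hp1.trans ?_
    gcongr
    exact le_max_right _ _

/-- The uniform version of `eventually_exists_near_levelCurve` along a periodic curve. -/
theorem Function.Periodic.exists_forall_near_levelCurve {E F : Type*} [NormedAddCommGroup E]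
    [NormedAddCommGroup F] {g : E → F} {γ : ℝ → E} {T : ℝ} {z : F} (hT : 0 < T)
    (hper : Function.Periodic γ T) (hγ : Continuous γ)
    (hloc : ∀ t₀, ∃ K : ℝ, ∀ᶠ p : ℝ × E in 𝓝 t₀ ×ˢ 𝓝 (γ t₀), ∃ s',
      |s' - p.1| ≤ K * dist p.2 (γ p.1) ∧ dist p.2 (γ s') ≤ K * ‖g p.2 - z‖) :
    ∃ K > 0, ∃ ρ > 0, ∀ s u, dist u (γ s) < ρ → ∃ s',
      |s' - s| ≤ K * dist u (γ s) ∧ dist u (γ s') ≤ K * ‖g u - z‖ := by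
  have hloc' : ∀ t₀ ∈ Icc 0 T, ∃ N ∈ 𝓝[Icc 0 T] t₀, ∃ K > 0, ∃ ρ > 0, ∀ s ∈ N, ∀ u,
      dist u (γ s) < ρ → ∃ s',
        |s' - s| ≤ K * dist u (γ s) ∧ dist u (γ s') ≤ K * ‖g u - z‖ := by
    intro t₀ _
    obtain ⟨K, hK⟩ := hloc t₀
    rw [← nhds_prod_eq] at hK
    obtain ⟨η, hη, hball⟩ := Metric.eventually_nhds_iff.1 hK
    have hN : ∀ᶠ s in 𝓝 t₀, dist s t₀ < η ∧ dist (γ s) (γ t₀) < η / 2 :=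
      (Metric.eventually_nhds_iff.2 ⟨η, hη, fun _ h => h⟩).and
        (Metric.tendsto_nhds.1 hγ.continuousAt _ (half_pos hη))
    refine ⟨_, mem_nhdsWithin_of_mem_nhds hN, max K 1, by positivity, η / 2, half_pos hη, ?_⟩
    rintro s ⟨hs1, hs2⟩ u hu
    obtain ⟨s', h1, h2⟩ := hball (y := (s, u)) (by
      rw [Prod.dist_eq]
      refine max_lt hs1 ((dist_triangle _ (γ s) _).trans_lt ?_)
      change dist u (γ s) + _ < _
      linarith)
    refine ⟨s', h1.trans ?_, h2.trans ?_⟩ <;> gcongr <;> exact le_max_left _ _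
  have hcomp : ∃ K > 0, ∃ ρ > 0, ∀ s ∈ Icc 0 T, ∀ u, dist u (γ s) < ρ → ∃ s',
      |s' - s| ≤ K * dist u (γ s) ∧ dist u (γ s') ≤ K * ‖g u - z‖ := by
    refine isCompact_Icc.induction_on (p := fun N => ∃ K > 0, ∃ ρ > 0, ∀ s ∈ N, ∀ u,
      dist u (γ s) < ρ → ∃ s', |s' - s| ≤ K * dist u (γ s) ∧ dist u (γ s') ≤ K * ‖g u - z‖)
      ?_ ?_ ?_ hloc'
    · exact ⟨1, one_pos, 1, one_pos, fun s hs => hs.elim⟩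
    · rintro N N' hN ⟨K, hK, ρ, hρ, h⟩
      exact ⟨K, hK, ρ, hρ, fun s hs => h s (hN hs)⟩
    · rintro N N' ⟨K, hK, ρ, hρ, h⟩ ⟨K', hK', ρ', hρ', h'⟩
      refine ⟨max K K', lt_max_of_lt_left hK, min ρ ρ', lt_min hρ hρ', fun s hs u hu => ?_⟩
      rcases hs with hs | hs
      · obtain ⟨s', h1, h2⟩ := h s hs u (hu.trans_le (min_le_left _ _))
        exact ⟨s', h1.trans (by gcongr; exact le_max_left _ _),
          h2.trans (by gcongr; exact le_max_left _ _)⟩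
      · obtain ⟨s', h1, h2⟩ := h' s hs u (hu.trans_le (min_le_right _ _))
        exact ⟨s', h1.trans (by gcongr; exact le_max_right _ _),
          h2.trans (by gcongr; exact le_max_right _ _)⟩
  obtain ⟨K, hK, ρ, hρ, h⟩ := hcomp
  refine ⟨K, hK, ρ, hρ, fun s u hu => ?_⟩
  obtain ⟨r, hr, n, hn⟩ : ∃ r ∈ Icc 0 T, ∃ n : ℤ, s = r + n * T := by
    refine ⟨toIcoMod hT 0 s, ?_, toIcoDiv hT 0 s, ?_⟩
    · have := toIcoMod_mem_Ico hT 0 s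
      rw [zero_add] at this
      exact Ico_subset_Icc_self this
    · rw [← zsmul_eq_mul, toIcoMod_add_toIcoDiv_zsmul]
  have hγn : ∀ r, γ (r + n * T) = γ r := fun r => hper.int_mul n r
  subst hn
  rw [hγn] at hu ⊢
  obtain ⟨s', h1, h2⟩ := h r hr u hu
  exact ⟨s' + n * T, by rwa [add_sub_add_right_eq_sub], by rwa [hγn]⟩

/-! ### Scalar linear differential inequalities -/

/-- A solution of `f' = A f` with `A ≤ κ` grows at most like `exp (κ t)`. -/
theorem abs_le_exp_mul_of_hasDerivAt_mul_self {f A : ℝ → ℝ} {κ t : ℝ} (ht : 0 ≤ t)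
    (hf : ContinuousOn f (Icc 0 t)) (hf' : ∀ s ∈ Ioo 0 t, HasDerivAt f (A s * f s) s)
    (hA : ∀ s ∈ Ioo 0 t, A s ≤ κ) : |f t| ≤ Real.exp (κ * t) * |f 0| := by
  have hanti : AntitoneOn (fun s => Real.exp (-(2 * κ) * s) * f s ^ 2) (Icc 0 t) := by
    refine antitoneOn_of_hasDerivWithinAt_nonpos (convex_Icc 0 t)
      (f' := fun s => 2 * Real.exp (-(2 * κ) * s) * f s ^ 2 * (A s - κ)) (by fun_prop) ?_ ?_
    · rw [interior_Icc]
      intro s hs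
      have h1 : HasDerivAt (fun s => Real.exp (-(2 * κ) * s))
          (Real.exp (-(2 * κ) * s) * (-(2 * κ) * 1)) s :=
        ((hasDerivAt_id s).const_mul _).exp
      have h2 := (h1.mul ((hf' s hs).pow 2)).hasDerivWithinAt (s := Ioo 0 t)
      convert! h2 using 1
      simp only [Pi.pow_apply]
      push_cast
      ring
    · rw [interior_Icc]
      intro s hs
      exact mul_nonpos_of_nonneg_of_nonpos (by positivity) (sub_nonpos.2 (hA s hs))
  have h := hanti ⟨le_rfl, ht⟩ ⟨ht, le_rfl⟩ ht
  simp only [mul_zero, Real.exp_zero, one_mul] at h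
  refine abs_le_of_sq_le_sq' ?_ (by positivity) |> abs_le.2
  calc f t ^ 2 = Real.exp (κ * t) ^ 2 * (Real.exp (-(2 * κ) * t) * f t ^ 2) := by
        rw [← mul_assoc, ← Real.exp_nat_mul, ← Real.exp_add]
        push_cast
        ring_nf
        simp
    _ ≤ Real.exp (κ * t) ^ 2 * f 0 ^ 2 := by gcongr
    _ = (Real.exp (κ * t) * |f 0|) ^ 2 := by rw [mul_pow, sq_abs]

/-- A solution of `f' = A f` with `A ≥ κ` grows at least like `exp (κ t)`. -/
theorem exp_mul_le_abs_of_hasDerivAt_mul_self {f A : ℝ → ℝ} {κ t : ℝ} (ht : 0 ≤ t)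
    (hf : ContinuousOn f (Icc 0 t)) (hf' : ∀ s ∈ Ioo 0 t, HasDerivAt f (A s * f s) s)
    (hA : ∀ s ∈ Ioo 0 t, κ ≤ A s) : Real.exp (κ * t) * |f 0| ≤ |f t| := by
  -- time reversal turns the lower bound into the upper one
  have h := abs_le_exp_mul_of_hasDerivAt_mul_self (f := fun s => f (t - s))
    (A := fun s => -A (t - s)) (κ := -κ) ht
    (hf.comp (by fun_prop) fun s hs => ⟨by linarith [hs.2], by linarith [hs.1]⟩)
    (fun s hs => by
      convert! (hf' (t - s) ⟨by linarith [hs.2], by linarith [hs.1]⟩).comp_const_sub t s using 1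
      ring)
    (fun s hs => neg_le_neg (hA _ ⟨by linarith [hs.2], by linarith [hs.1]⟩))
  simp only [sub_self, sub_zero] at h
  calc Real.exp (κ * t) * |f 0| ≤ Real.exp (κ * t) * (Real.exp (-κ * t) * |f t|) := by gcongr
    _ = |f t| := by rw [← mul_assoc, ← Real.exp_add]; simp

/-! ### Attraction with asymptotic phase -/

/-- Suppose that along solutions starting in `S` the defect `‖g - z‖` decays exponentially for as
long as they stay close to the curve `γ`, and that `‖g - z‖` controls the distance to `γ` in the
quantitative sense of `Function.Periodic.exists_forall_near_levelCurve`. Then solutions starting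
in `S` close to `γ` stay close to `γ` and are asymptotic to a time shift of `γ`.

At the integer time `n` the solution is compared with a point `γ (σ n)`. By Grönwall's inequality
the two solutions stay close during `[n, n + 1]`, and `σ (n + 1)` differs from `σ n + 1` by a
multiple of the defect at time `n`, so that `σ n - n` converges geometrically. -/
theorem tendsto_dist_integralCurve_of_exp_decay {E F : Type*} [NormedAddCommGroup E]
    [NormedSpace ℝ E] [NormedAddCommGroup F] {Z : E → E} {M L : NNReal} (hM : LipschitzWith M Z)
    (hL : ∀ u, ‖Z u‖ ≤ L) {γ : ℝ → E} (hγ : IsIntegralCurve γ (fun _ => Z)) {g : E → F} {z : F}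
    {S : Set E} {K ρ ε₀ μ : ℝ} (hK : 0 < K) (hρ : 0 < ρ) (hε₀ : 0 < ε₀) (hμ : 0 < μ)
    (hnear : ∀ s u, dist u (γ s) < ρ → ∃ s',
      |s' - s| ≤ K * dist u (γ s) ∧ dist u (γ s') ≤ K * ‖g u - z‖)
    (hcont : ∀ η > 0, ∃ δ > 0, ∀ u, Metric.infDist u (range γ) < δ → ‖g u - z‖ < η)
    (hdecay : ∀ x, IsIntegralCurve x (fun _ => Z) → x 0 ∈ S → ∀ t, 0 ≤ t →
      (∀ r ∈ Icc 0 t, Metric.infDist (x r) (range γ) < ε₀) →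
        ‖g (x t) - z‖ ≤ Real.exp (-μ * t) * ‖g (x 0) - z‖)
    {ε : ℝ} (hε : 0 < ε) :
    ∃ δ > 0, ∀ x, IsIntegralCurve x (fun _ => Z) → x 0 ∈ S →
      Metric.infDist (x 0) (range γ) < δ →
        (∀ t, 0 ≤ t → Metric.infDist (x t) (range γ) < ε) ∧
        ∃ θ : ℝ, Tendsto (fun t => dist (x t) (γ (t + θ))) atTop (𝓝 0) := by
  wlog hεε₀ : ε ≤ ε₀ generalizing ε
  · obtain ⟨δ, hδ, h⟩ := this hε₀ le_rfl
    refine ⟨δ, hδ, fun x hx hxS hx0 => ?_⟩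
    obtain ⟨h1, h2⟩ := h x hx hxS hx0
    exact ⟨fun t ht => (h1 t ht).trans (not_le.1 hεε₀), h2⟩
  set B : ℝ := Real.exp M with hB
  have hBpos : 0 < B := Real.exp_pos _
  -- a defect below `η` gives a distance below `K * η`, which grows to less than `ε` and `ρ` within
  -- a unit of time
  set η : ℝ := min ε ρ / (2 * (K * B)) with hη
  have hηpos : 0 < η := by have := lt_min hε hρ; positivity
  have hηsmall : K * η * B < min ε ρ := by
    have : K * η * B = min ε ρ / 2 := by rw [hη]; field_simp
    rw [this]
    exact half_lt_self (lt_min hε hρ)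
  obtain ⟨δ, hδ, hδη⟩ := hcont η hηpos
  refine ⟨min δ ρ, lt_min hδ hρ, fun x hx hxS hx0 => ?_⟩
  have hℓ0 : ‖g (x 0) - z‖ < η := hδη _ (hx0.trans_le (min_le_left _ _))
  set q : ℝ := Real.exp (-μ) with hq
  have hqpos : 0 < q := Real.exp_pos _
  have hq1 : q < 1 := Real.exp_lt_one_iff.2 (by linarith)
  have hinf : ∀ u s, Metric.infDist u (range γ) ≤ dist u (γ s) := fun u s =>
    Metric.infDist_le_dist_of_mem (mem_range_self s)
  let good : ℕ → ℝ → Prop := fun n s => dist (x n) (γ s) ≤ K * ‖g (x n) - z‖ ∧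
    ∀ r ∈ Icc (0 : ℝ) n, Metric.infDist (x r) (range γ) < ε
  have hfollow : ∀ n s, good n s → ∀ r ∈ Icc (0 : ℝ) 1,
      dist (x (n + r)) (γ (s + r)) ≤ K * η * B * q ^ n := by
    rintro n s ⟨h1, h2⟩ r hr
    have h3 := hdecay x hx hxS n n.cast_nonneg fun r hr => (h2 r hr).trans_le hεε₀
    have h4 : Real.exp (-μ * n) = q ^ n := by rw [hq, ← Real.exp_nat_mul]; ring_nf
    rw [h4] at h3
    have h5 : dist (x n) (γ s) ≤ K * (q ^ n * η) := by
      refine h1.trans ?_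
      gcongr
      exact h3.trans (by gcongr)
    calc _ ≤ dist (x n) (γ s) * Real.exp (M * r) := dist_integralCurve_add_le hM hx hγ _ _ hr.1
      _ ≤ (K * (q ^ n * η)) * B := by
        gcongr
        rw [hB]
        gcongr
        exact mul_le_of_le_one_right M.coe_nonneg hr.2
      _ = _ := by ring
  have hfollow' : ∀ n s, good n s → ∀ r ∈ Icc (0 : ℝ) 1,
      dist (x (n + r)) (γ (s + r)) < min ε ρ := fun n s h r hr =>
    (hfollow n s h r hr).trans_lt <| lt_of_le_of_lt
      (mul_le_of_le_one_right (by positivity) (pow_le_one₀ hqpos.le hq1.le)) hηsmall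
  have hstep : ∀ n s, ∃ s', good n s → good (n + 1) s' ∧
      |s' - (s + 1)| ≤ K * (K * η * B * q ^ n) := by
    intro n s
    by_cases h : good n s
    swap
    · exact ⟨0, fun h' => (h h').elim⟩
    have h1 := hfollow' n s h 1 ⟨zero_le_one, le_rfl⟩
    obtain ⟨s', hs1, hs2⟩ := hnear (s + 1) (x (n + 1)) (h1.trans_le (min_le_right _ _))
    refine ⟨s', fun _ => ⟨⟨by exact_mod_cast hs2, fun r hr => ?_⟩, hs1.trans ?_⟩⟩
    · rcases le_total r n with hrn | hrn
      · exact h.2 r ⟨hr.1, hrn⟩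
      · have h2 := hfollow' n s h (r - n) ⟨by linarith, by
          have := hr.2
          push_cast at this
          linarith⟩
        rw [add_sub_cancel] at h2
        exact (hinf _ _).trans_lt (h2.trans_le (min_le_left _ _))
    · gcongr
      exact hfollow n s h 1 ⟨zero_le_one, le_rfl⟩
  choose f hf using hstep
  obtain ⟨s₀, hs₀⟩ : ∃ s₀, good 0 s₀ := by
    obtain ⟨y, ⟨s, rfl⟩, hy⟩ := (Metric.infDist_lt_iff (range_nonempty γ)).1
      (hx0.trans_le (min_le_right _ _))
    obtain ⟨s', -, hs'⟩ := hnear s (x 0) hy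
    refine ⟨s', by simpa using hs', fun r hr => ?_⟩
    obtain rfl : r = 0 := le_antisymm (by simpa using hr.2) hr.1
    refine (hinf _ s').trans_lt (lt_of_le_of_lt ?_ (hηsmall.trans_le (min_le_left _ _)))
    calc dist (x 0) (γ s') ≤ K * η * 1 := by rw [mul_one]; exact hs'.trans (by gcongr)
      _ ≤ K * η * B := by gcongr; exact Real.one_le_exp M.coe_nonneg
  let σ : ℕ → ℝ := fun n => Nat.rec s₀ f n
  have hσ : ∀ n, good n (σ n) := by
    intro n
    induction n with
    | zero => exact hs₀
    | succ n ih => exact (hf n (σ n) ih).1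
  have hσ' : ∀ n, |σ (n + 1) - (σ n + 1)| ≤ K * (K * η * B * q ^ n) := fun n =>
    (hf n (σ n) (hσ n)).2
  have hfloor : ∀ t : ℝ, 0 ≤ t → t - ⌊t⌋₊ ∈ Icc (0 : ℝ) 1 := fun t ht =>
    ⟨sub_nonneg.2 (Nat.floor_le ht), by linarith [Nat.lt_floor_add_one t]⟩
  refine ⟨fun t ht => ?_, ?_⟩
  · have := hfollow' _ _ (hσ ⌊t⌋₊) _ (hfloor t ht)
    rw [add_sub_cancel] at this
    exact (hinf _ _).trans_lt (this.trans_le (min_le_left _ _))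
  have hcauchy : CauchySeq fun n => σ n - n := by
    refine cauchySeq_of_le_geometric q (K * (K * η * B)) hq1 fun n => ?_
    rw [dist_comm, Real.dist_eq]
    convert hσ' n using 1
    · push_cast
      ring_nf
    · ring
  obtain ⟨θ, hθ⟩ := cauchySeq_tendsto_of_complete hcauchy
  have hγL : LipschitzWith L γ :=
    lipschitzWith_of_nnnorm_deriv_le (fun t => (hγ t).differentiableAt) fun t => by
      rw [(hγ t).deriv]
      exact_mod_cast hL _
  refine ⟨θ, ?_⟩
  have hlim : Tendsto (fun n : ℕ => K * η * B * q ^ n + L * dist (σ n - n) θ) atTop (𝓝 0) := by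
    have h1 := (tendsto_pow_atTop_nhds_zero_of_lt_one hqpos.le hq1).const_mul (K * η * B)
    have h2 := (tendsto_iff_dist_tendsto_zero.1 hθ).const_mul (L : ℝ)
    simpa using h1.add h2
  refine squeeze_zero' (Eventually.of_forall fun _ => dist_nonneg) ?_
    (hlim.comp (tendsto_nat_floor_atTop (α := ℝ)))
  filter_upwards [eventually_ge_atTop 0] with t ht
  have h1 := hfollow _ _ (hσ ⌊t⌋₊) _ (hfloor t ht)
  rw [add_sub_cancel] at h1
  have h2 := hγL.dist_le_mul (σ ⌊t⌋₊ + (t - ⌊t⌋₊)) (t + θ)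
  have h3 : dist (σ ⌊t⌋₊ + (t - ⌊t⌋₊)) (t + θ) = dist (σ ⌊t⌋₊ - ⌊t⌋₊) θ := by
    rw [Real.dist_eq, Real.dist_eq]
    ring_nf
  rw [h3] at h2
  exact (dist_triangle _ _ _).trans (add_le_add h1 h2)

/-! ### Periodic orbits -/

namespace Stab3D

theorem IsPeriodicOrbit.hasDerivAt {Y : E3 → E3} {V : Set E3} {γ : ℝ → E3} {T : ℝ}
    (hγ : IsPeriodicOrbit Y V γ T) (t : ℝ) : HasDerivAt γ (Y (γ t)) t :=
  isIntegralCurveOn_univ.1 hγ.solution.1 t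

theorem IsPeriodicOrbit.mem {Y : E3 → E3} {V : Set E3} {γ : ℝ → E3} {T : ℝ}
    (hγ : IsPeriodicOrbit Y V γ T) (t : ℝ) : γ t ∈ V :=
  hγ.solution.2 t (mem_univ t)

theorem IsPeriodicOrbit.continuous {Y : E3 → E3} {V : Set E3} {γ : ℝ → E3} {T : ℝ}
    (hγ : IsPeriodicOrbit Y V γ T) : Continuous γ :=
  continuous_iff_continuousAt.2 fun t => (hγ.hasDerivAt t).continuousAt

theorem IsPeriodicOrbit.isCompact_range {Y : E3 → E3} {V : Set E3} {γ : ℝ → E3} {T : ℝ}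
    (hγ : IsPeriodicOrbit Y V γ T) : IsCompact (range γ) :=
  hγ.periodic.compact_of_continuous hγ.period_pos.ne' hγ.continuous

theorem IsPeriodicOrbit.range_subset {Y : E3 → E3} {V : Set E3} {γ : ℝ → E3} {T : ℝ}
    (hγ : IsPeriodicOrbit Y V γ T) : range γ ⊆ V :=
  range_subset_iff.2 hγ.mem

theorem IsPeriodicOrbit.congr {Y Y' : E3 → E3} {V : Set E3} {γ : ℝ → E3} {T : ℝ}
    (hγ : IsPeriodicOrbit Y V γ T) (h : ∀ t, Y' (γ t) = Y (γ t)) : IsPeriodicOrbit Y' V γ T where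
  period_pos := hγ.period_pos
  solution := ⟨fun t ht => by
    have := hγ.solution.1 t ht
    simp only [← h t] at this
    exact this, hγ.solution.2⟩
  periodic := hγ.periodic
  nonconstant := hγ.nonconstant

/-- A periodic orbit of a `C¹` field contains no equilibrium, by uniqueness of solutions. -/
theorem IsPeriodicOrbit.apply_ne_zero {Y : E3 → E3} {V : Set E3} {γ : ℝ → E3} {T : ℝ}
    (hV : IsOpen V) (hY : ContDiffOn ℝ 1 Y V) (hγ : IsPeriodicOrbit Y V γ T) (t₀ : ℝ) :
    Y (γ t₀) ≠ 0 := by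
  intro h0
  obtain ⟨Z, K, L, hK, -, ε, hε, hZ⟩ :=
    exists_lipschitzWith_bounded_eqOn_thickening hV hγ.isCompact_range hγ.range_subset hY
  have hZγ : ∀ t, Z (γ t) = Y (γ t) := fun t =>
    (hZ _ (Metric.self_subset_thickening hε _ (mem_range_self t))).2
  have hconst : γ = fun _ => γ t₀ := by
    refine ODE_solution_unique_univ (v := fun _ => Z) (s := fun _ => univ) (K := K) (t₀ := t₀)
      (fun _ => hK.lipschitzOnWith) (fun t => ⟨?_, mem_univ _⟩) (fun t => ⟨?_, mem_univ _⟩) rfl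
    · rw [hZγ]
      exact hγ.hasDerivAt t
    · rw [hZγ, h0]
      exact hasDerivAt_const t _
  obtain ⟨t, ht⟩ := hγ.nonconstant
  exact ht (by rw [congrFun hconst t, congrFun hconst 0])

/-- If some function `F` satisfies `F' = κ (F - f)` with `κ > 0` along solutions, and there are
initial conditions in `S` arbitrarily close to the orbit with `F ≠ f`, then the orbit is unstable:
`F - f` grows exponentially along these solutions, although it is bounded near the orbit. -/
theorem IsPeriodicOrbit.orbitallyUnstable {Y : E3 → E3} {V S : Set E3} {γ : ℝ → E3} {T : ℝ}
    (hV : IsOpen V) (hγ : IsPeriodicOrbit Y V γ T) {F κ : E3 → ℝ} {f : ℝ}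
    (hF : ∀ u ∈ V, DifferentiableAt ℝ F u) (hκ : ContinuousOn κ V) (hκ0 : ∀ u ∈ V, 0 < κ u)
    (hFY : ∀ u ∈ V, fderiv ℝ F u (Y u) = κ u * (F u - f))
    (hS : ∀ δ > 0, ∃ x₀ ∈ S, Metric.infDist x₀ (range γ) < δ ∧ F x₀ ≠ f) :
    OrbitallyUnstable Y V S γ := by
  intro hstab
  obtain ⟨ε, hε, hεV⟩ := hγ.isCompact_range.exists_cthickening_subset_open hV hγ.range_subset
  have hcomp : IsCompact (Metric.cthickening ε (range γ)) := hγ.isCompact_range.cthickening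
  have hmem : ∀ u, Metric.infDist u (range γ) < ε → u ∈ Metric.cthickening ε (range γ) :=
    fun u hu => Metric.thickening_subset_cthickening _ _
      ((Metric.mem_thickening_iff_infDist_lt (range_nonempty γ)).2 hu)
  obtain ⟨u₀, hu₀, hmin⟩ := hcomp.exists_isMinOn
    ⟨γ 0, Metric.self_subset_cthickening _ (mem_range_self 0)⟩ (hκ.mono hεV)
  have hFc : ContinuousOn F V := fun u hu => (hF u hu).continuousAt.continuousWithinAt
  obtain ⟨B, hB⟩ := hcomp.exists_bound_of_continuousOn
    ((hFc.mono hεV).sub (continuousOn_const (c := f)))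
  obtain ⟨δ, hδ, hstab⟩ := hstab ε hε
  obtain ⟨x₀, hx₀S, hx₀, hFx₀⟩ := hS δ hδ
  obtain ⟨x, ⟨hx, hxV⟩, hx0, hxε⟩ := hstab x₀ hx₀S hx₀
  have hder : ∀ t, 0 < t → HasDerivAt (fun t => F (x t) - f) (κ (x t) * (F (x t) - f)) t := by
    intro t ht
    rw [← hFY _ (hxV t ht.le)]
    exact ((hF _ (hxV t ht.le)).hasFDerivAt.comp_hasDerivAt t
      ((hx t ht.le).hasDerivAt (Ici_mem_nhds ht))).sub_const f
  have hgrow : ∀ t, 0 < t → Real.exp (κ u₀ * t) * |F x₀ - f| ≤ B := by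
    intro t ht
    have h1 := exp_mul_le_abs_of_hasDerivAt_mul_self (f := fun t => F (x t) - f)
      (A := fun t => κ (x t)) (κ := κ u₀) ht.le ?_ (fun s hs => hder s hs.1)
      (fun s hs => hmin (hmem _ (hxε s hs.1)))
    · rw [hx0] at h1
      exact h1.trans (hB _ (hmem _ (hxε t ht)))
    · have hxc : ContinuousOn x (Icc 0 t) := fun s hs =>
        ((hx s hs.1).continuousWithinAt).mono Icc_subset_Ici_self
      exact (hFc.comp hxc fun s hs => hxV s hs.1).sub continuousOn_const
  have hlim : Tendsto (fun t => Real.exp (κ u₀ * t) * |F x₀ - f|) atTop atTop :=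
    (Real.tendsto_exp_atTop.comp (tendsto_id.const_mul_atTop (hκ0 _ (hεV hu₀)))).atTop_mul_const
      (abs_pos.2 (sub_ne_zero.2 hFx₀))
  obtain ⟨t, ht1, ht2⟩ := ((hlim.eventually_gt_atTop B).and (eventually_gt_atTop 0)).exists
  exact absurd (hgrow t ht2) (not_le.2 ht1)

end Stab3D

namespace Stab3D

/-! ### Vector algebra -/

theorem inner_cross_self_left (a b : E3) : inner ℝ a (cross a b) = 0 := by
  simp [cross, crossProduct, PiLp.inner_apply, Fin.sum_univ_three]
  ring

theorem inner_cross_self_right (a b : E3) : inner ℝ b (cross a b) = 0 := by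
  simp [cross, crossProduct, PiLp.inner_apply, Fin.sum_univ_three]
  ring

theorem inner_left_cross_right_cross (a b : E3) :
    inner ℝ a (cross b (cross a b)) = ‖cross a b‖ ^ 2 := by
  rw [EuclideanSpace.real_norm_sq_eq]
  simp [cross, crossProduct, PiLp.inner_apply, Fin.sum_univ_three]
  ring

theorem inner_right_cross_left_cross (a b : E3) :
    inner ℝ b (cross a (cross a b)) = -‖cross a b‖ ^ 2 := by
  rw [EuclideanSpace.real_norm_sq_eq]
  simp [cross, crossProduct, PiLp.inner_apply, Fin.sum_univ_three]
  ring

theorem cross_ne_zero {a b : E3} (h : LinearIndependent ℝ ![a, b]) : cross a b ≠ 0 := by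
  have h' : LinearIndependent ℝ ![a.ofLp, b.ofLp] := by
    rw [LinearIndependent.pair_iff] at h ⊢
    exact fun s t hst => h s t (congrArg (WithLp.toLp 2) hst)
  intro h0
  exact crossProduct_ne_zero_iff_linearIndependent.2 h' (congrArg WithLp.ofLp h0)

theorem norm_cross_sq_mul_norm_sq (a b v : E3) (ha : inner ℝ a v = 0) (hb : inner ℝ b v = 0) :
    ‖cross a b‖ ^ 2 * ‖v‖ ^ 2 = inner ℝ (cross a b) v ^ 2 := by
  -- the difference of the two sides is `‖cross a b × v‖²`, and `(a × b) × v = ⟪a, v⟫ b - ⟪b, v⟫ a`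
  rw [EuclideanSpace.real_norm_sq_eq, EuclideanSpace.real_norm_sq_eq]
  simp only [cross, crossProduct, PiLp.inner_apply, Fin.sum_univ_three, RCLike.inner_apply,
    conj_trivial, LinearMap.mk₂_apply, Matrix.cons_val] at *
  linear_combination
    ((b 0 ^ 2 + b 1 ^ 2 + b 2 ^ 2) * (v 0 * a 0 + v 1 * a 1 + v 2 * a 2)
      - 2 * (a 0 * b 0 + a 1 * b 1 + a 2 * b 2) * (v 0 * b 0 + v 1 * b 1 + v 2 * b 2)) * ha
    + ((a 0 ^ 2 + a 1 ^ 2 + a 2 ^ 2) * (v 0 * b 0 + v 1 * b 1 + v 2 * b 2)) * hb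

theorem _root_.ContDiffOn.cross {V : Set E3} {n : WithTop ℕ∞} {X Y : E3 → E3}
    (hX : ContDiffOn ℝ n X V) (hY : ContDiffOn ℝ n Y V) :
    ContDiffOn ℝ n (fun u => cross (X u) (Y u)) V := by
  have hX' : ∀ i, ContDiffOn ℝ n (fun u => X u i) V := contDiffOn_euclidean.1 hX
  have hY' : ∀ i, ContDiffOn ℝ n (fun u => Y u i) V := contDiffOn_euclidean.1 hY
  refine contDiffOn_euclidean.2 fun i => ?_
  fin_cases i
  · exact ((hX' 1).mul (hY' 2)).sub ((hX' 2).mul (hY' 1))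
  · exact ((hX' 2).mul (hY' 0)).sub ((hX' 0).mul (hY' 2))
  · exact ((hX' 0).mul (hY' 1)).sub ((hX' 1).mul (hY' 0))

theorem _root_.ContDiffOn.gradient {V : Set E3} (hV : IsOpen V) {F : E3 → ℝ}
    (hF : ContDiffOn ℝ ∞ F V) : ContDiffOn ℝ ∞ (∇ F) V :=
  (InnerProductSpace.toDual ℝ E3).symm.toContinuousLinearEquiv.contDiff.comp_contDiffOn
    (hF.fderiv_of_isOpen hV (m := ∞) (by simp))

theorem fderiv_eq_inner_gradient {F : E3 → ℝ} (u v : E3) :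
    fderiv ℝ F u v = inner ℝ (∇ F u) v := by
  rw [← toDual_gradient, InnerProductSpace.toDual_apply_apply]

end Stab3D

namespace Stab3D

/-! ### The perturbed Hamiltonian fields -/

theorem hTerm_neg (H C : E3 → ℝ) (h : ℝ) (α : E3 → ℝ) :
    hTerm H C h (-α) = -hTerm H C h α := by
  ext1 u
  simp [hTerm]

theorem cTerm_neg (H C : E3 → ℝ) (c : ℝ) (β : E3 → ℝ) :
    cTerm H C c (-β) = -cTerm H C c β := by
  ext1 u
  simp [cTerm]

theorem cTerm_zero (H C : E3 → ℝ) (c : ℝ) : cTerm H C c 0 = 0 := by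
  ext1 u
  simp [cTerm]

/-- The common form `ν (∇H × ∇C) - α (H - h) [∇C × (∇H × ∇C)] + β (C - c) [∇H × (∇H × ∇C)]` of the
perturbed fields, for coefficient functions `α` and `β` of arbitrary sign. -/
noncomputable def perturbedField (ν H C : E3 → ℝ) (h c : ℝ) (α β : E3 → ℝ) : E3 → E3 :=
  hamField ν H C - hTerm H C h α + cTerm H C c β

section Fields

variable (ν H C : E3 → ℝ) (h c : ℝ) (α β : E3 → ℝ)

theorem hamField_sub_hTerm :
    hamField ν H C - hTerm H C h α = perturbedField ν H C h c α 0 := by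
  rw [perturbedField, cTerm_zero, add_zero]

theorem hamField_add_hTerm :
    hamField ν H C + hTerm H C h α = perturbedField ν H C h c (-α) 0 := by
  rw [perturbedField, cTerm_zero, add_zero, hTerm_neg, sub_neg_eq_add]

theorem hamField_add_hTerm_add_cTerm :
    hamField ν H C + hTerm H C h α + cTerm H C c β = perturbedField ν H C h c (-α) β := by
  rw [perturbedField, hTerm_neg, sub_neg_eq_add]

theorem hamField_sub_hTerm_sub_cTerm :
    hamField ν H C - hTerm H C h α - cTerm H C c β = perturbedField ν H C h c α (-β) := by
  rw [perturbedField, cTerm_neg, sub_eq_add_neg]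

theorem hamField_add_hTerm_sub_cTerm :
    hamField ν H C + hTerm H C h α - cTerm H C c β = perturbedField ν H C h c (-α) (-β) := by
  rw [perturbedField, hTerm_neg, sub_neg_eq_add, cTerm_neg, sub_eq_add_neg]

/-- The `β`-term is orthogonal to `∇H`, so `H - h` obeys a scalar linear equation along
solutions. -/
theorem fderiv_left_perturbedField (u : E3) :
    fderiv ℝ H u (perturbedField ν H C h c α β u) =
      (-α u * ‖cross (∇ H u) (∇ C u)‖ ^ 2) * (H u - h) := by
  rw [fderiv_eq_inner_gradient]
  simp only [perturbedField, hamField, hTerm, cTerm, Pi.add_apply, Pi.sub_apply, inner_add_right,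
    inner_sub_right, inner_smul_right, inner_cross_self_left, inner_left_cross_right_cross]
  ring

/-- The `α`-term is orthogonal to `∇C`, so `C - c` obeys a scalar linear equation along
solutions. -/
theorem fderiv_right_perturbedField (u : E3) :
    fderiv ℝ C u (perturbedField ν H C h c α β u) =
      (-β u * ‖cross (∇ H u) (∇ C u)‖ ^ 2) * (C u - c) := by
  rw [fderiv_eq_inner_gradient]
  simp only [perturbedField, hamField, hTerm, cTerm, Pi.add_apply, Pi.sub_apply, inner_add_right,
    inner_sub_right, inner_smul_right, inner_cross_self_left, inner_cross_self_right,
    inner_right_cross_left_cross]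
  ring

variable {ν H C h c α β}

theorem perturbedField_eq_hamField {u : E3} (hu : H u = h ∧ C u = c) :
    perturbedField ν H C h c α β u = hamField ν H C u := by
  simp [perturbedField, hTerm, cTerm, hu.1, hu.2]

theorem contDiffOn_perturbedField {V : Set E3} (hV : IsOpen V) (hν : ContDiffOn ℝ ∞ ν V)
    (hH : ContDiffOn ℝ ∞ H V) (hC : ContDiffOn ℝ ∞ C V) (hα : ContDiffOn ℝ ∞ α V)
    (hβ : ContDiffOn ℝ ∞ β V) : ContDiffOn ℝ ∞ (perturbedField ν H C h c α β) V := by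
  have hHg := hH.gradient hV
  have hCg := hC.gradient hV
  have hn := hHg.cross hCg
  exact ((hν.smul hn).sub ((hα.mul (hH.sub contDiffOn_const)).smul (hCg.cross hn))).add
    ((hβ.mul (hC.sub contDiffOn_const)).smul (hHg.cross hn))

theorem continuousOn_mul_norm_cross_gradient_sq {V : Set E3} (hV : IsOpen V)
    (hH : ContDiffOn ℝ ∞ H V) (hC : ContDiffOn ℝ ∞ C V) (hα : ContDiffOn ℝ ∞ α V) :
    ContinuousOn (fun u => α u * ‖cross (∇ H u) (∇ C u)‖ ^ 2) V :=
  hα.continuousOn.mul ((((hH.gradient hV).cross (hC.gradient hV)).continuousOn.norm).pow 2)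

theorem FunctionallyIndependentOn.mul_norm_cross_sq_pos {V : Set E3}
    (hind : FunctionallyIndependentOn H C V) (hα : ∀ u ∈ V, 0 < α u) {u : E3} (hu : u ∈ V) :
    0 < α u * ‖cross (∇ H u) (∇ C u)‖ ^ 2 := by
  have := hα u hu
  have := norm_pos_iff.2 (cross_ne_zero (hind u hu))
  positivity

/-- With `β = 0` the function `C` is constant along solutions. -/
theorem isInvariantSet_perturbedField_zero {V : Set E3} (hV : IsOpen V)
    (hC : ContDiffOn ℝ ∞ C V) :
    IsInvariantSet (perturbedField ν H C h c α 0) V (V ∩ C ⁻¹' {c}) := by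
  rintro x J hJ ⟨hx, hxV⟩ t₀ ht₀ hxt₀ t ht
  have hder : ∀ s ∈ J, HasDerivWithinAt (fun s => C (x s)) 0 J s := by
    intro s hs
    have hCd : DifferentiableAt ℝ C (x s) :=
      (hC.contDiffAt (hV.mem_nhds (hxV s hs))).differentiableAt (by simp)
    have h1 := hCd.hasFDerivAt.comp_hasDerivWithinAt s (hx s hs)
    rw [fderiv_right_perturbedField] at h1
    simpa using! h1
  have h2 := hJ.convex.norm_image_sub_le_of_norm_hasDerivWithin_le (C := 0) hder (by simp) ht₀ ht
  rw [zero_mul, norm_le_zero_iff, sub_eq_zero] at h2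
  exact ⟨hxV t ht, h2.trans hxt₀.2⟩

end Fields

/-! ### Stability and instability of the orbit -/

/-- The error bound `Function.Periodic.exists_forall_near_levelCurve` for an orbit in a level set
of `(H, C)`. The transversal coordinate is the linear form given by the vector `∇H × ∇C` at the
base point, to which the velocity of the orbit is proportional. -/
theorem exists_forall_near_hamiltonianOrbit {V : Set E3} (hV : IsOpen V) {H C ν : E3 → ℝ}
    (hν : ContDiffOn ℝ ∞ ν V) (hH : ContDiffOn ℝ ∞ H V) (hC : ContDiffOn ℝ ∞ C V)
    (hind : FunctionallyIndependentOn H C V) {γ : ℝ → E3} {T : ℝ}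
    (hγ : IsPeriodicOrbit (hamField ν H C) V γ T) {h c : ℝ}
    (hlevel : ∀ t, H (γ t) = h ∧ C (γ t) = c) :
    ∃ K > 0, ∃ ρ > 0, ∀ s u, dist u (γ s) < ρ → ∃ s',
      |s' - s| ≤ K * dist u (γ s) ∧ dist u (γ s') ≤ K * ‖(H u, C u) - (h, c)‖ := by
  refine hγ.periodic.exists_forall_near_levelCurve (g := fun u => (H u, C u)) hγ.period_pos
    hγ.continuous fun t₀ => ?_
  have hmem := hV.mem_nhds (hγ.mem t₀)
  have hHd : HasStrictFDerivAt H (fderiv ℝ H (γ t₀)) (γ t₀) :=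
    (hH.contDiffAt hmem).hasStrictFDerivAt (by simp)
  have hCd : HasStrictFDerivAt C (fderiv ℝ C (γ t₀)) (γ t₀) :=
    (hC.contDiffAt hmem).hasStrictFDerivAt (by simp)
  have hY : ContDiffOn ℝ ∞ (hamField ν H C) V := hν.smul ((hH.gradient hV).cross (hC.gradient hV))
  have hYγ : ContinuousAt (fun t => hamField ν H C (γ t)) t₀ :=
    (hY.continuousOn.continuousAt hmem).comp hγ.continuous.continuousAt
  have hγd : HasStrictDerivAt γ (hamField ν H C (γ t₀)) t₀ :=
    hasStrictDerivAt_of_hasDerivAt_of_continuousAt (Eventually.of_forall hγ.hasDerivAt) hYγ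
  set n := cross (∇ H (γ t₀)) (∇ C (γ t₀)) with hn
  have hn0 : n ≠ 0 := cross_ne_zero (hind _ (hγ.mem t₀))
  have hw0 : hamField ν H C (γ t₀) ≠ 0 :=
    hγ.apply_ne_zero hV (hY.of_le (by exact_mod_cast le_top)) t₀
  refine eventually_exists_near_levelCurve (l := innerSL ℝ n) (hHd.prodMk hCd) hγd ?_ ?_
    fun t => Prod.ext (hlevel t).1 (hlevel t).2
  · have hν0 : ν (γ t₀) ≠ 0 := fun h0 => hw0 (by simp [hamField, h0])
    have : innerSL ℝ n (hamField ν H C (γ t₀)) = ν (γ t₀) * ‖n‖ ^ 2 := by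
      rw [hamField, ← hn, innerSL_apply_apply, inner_smul_right, real_inner_self_eq_norm_sq]
    rw [this]
    exact mul_ne_zero hν0 (pow_ne_zero 2 (norm_ne_zero_iff.2 hn0))
  · intro v hv hnv
    have hv' : (fderiv ℝ H (γ t₀) v, fderiv ℝ C (γ t₀) v) = (0, 0) := hv
    rw [fderiv_eq_inner_gradient, fderiv_eq_inner_gradient, Prod.mk.injEq] at hv'
    have h1 := norm_cross_sq_mul_norm_sq _ _ v hv'.1 hv'.2
    rw [← hn, ← innerSL_apply_apply ℝ, hnv, zero_pow two_ne_zero, mul_eq_zero] at h1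
    exact norm_eq_zero.1 (pow_eq_zero_iff two_ne_zero |>.1
      (h1.resolve_left (pow_ne_zero 2 (norm_ne_zero_iff.2 hn0))))

/-- Stability: for `α > 0` the function `H - h` decays along solutions near the orbit, and `C - c`
decays or, for `β = 0` and initial conditions in the level set of `C`, vanishes. -/
theorem orbitallyPhaseAsymptoticallyStable_perturbedField {V : Set E3} (hV : IsOpen V)
    {H C ν α β : E3 → ℝ} (hν : ContDiffOn ℝ ∞ ν V) (hH : ContDiffOn ℝ ∞ H V)
    (hC : ContDiffOn ℝ ∞ C V) (hind : FunctionallyIndependentOn H C V) {γ : ℝ → E3} {T : ℝ}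
    (hγ : IsPeriodicOrbit (hamField ν H C) V γ T) {h c : ℝ}
    (hlevel : ∀ t, H (γ t) = h ∧ C (γ t) = c) (hα : IsSmoothPos V α) {S : Set E3}
    (hβ : IsSmoothPos V β ∨ β = 0 ∧ S ⊆ C ⁻¹' {c}) :
    OrbitallyPhaseAsymptoticallyStable (perturbedField ν H C h c α β) V S γ := by
  have hβs : ContDiffOn ℝ ∞ β V := by
    rcases hβ with hβ | ⟨rfl, -⟩
    exacts [hβ.1, contDiffOn_const]
  have hY : ContDiffOn ℝ ∞ (perturbedField ν H C h c α β) V :=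
    contDiffOn_perturbedField hV hν hH hC hα.1 hβs
  have hΓ := hγ.isCompact_range
  have hne : (range γ).Nonempty := range_nonempty γ
  obtain ⟨Z, M, L, hM, hL, ε₁, hε₁, hZ⟩ := exists_lipschitzWith_bounded_eqOn_thickening hV hΓ
    hγ.range_subset (hY.of_le (by exact_mod_cast le_top))
  obtain ⟨ε₂, hε₂, hε₂V⟩ := hΓ.exists_cthickening_subset_open hV hγ.range_subset
  have hcomp : IsCompact (Metric.cthickening ε₂ (range γ)) := hΓ.cthickening
  set ε₀ := min ε₁ ε₂ with hε₀
  have hε₀pos : 0 < ε₀ := lt_min hε₁ hε₂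
  have hin₁ : ∀ u, Metric.infDist u (range γ) < ε₀ →
      u ∈ V ∧ Z u = perturbedField ν H C h c α β u := fun u hu =>
    hZ u ((Metric.mem_thickening_iff_infDist_lt hne).2 (hu.trans_le (min_le_left _ _)))
  have hin₂ : ∀ u, Metric.infDist u (range γ) < ε₀ → u ∈ Metric.cthickening ε₂ (range γ) :=
    fun u hu => Metric.thickening_subset_cthickening _ _
      ((Metric.mem_thickening_iff_infDist_lt hne).2 (hu.trans_le (min_le_right _ _)))
  have hZγ : IsIntegralCurve γ (fun _ => Z) := fun t => by
    have h0 : Metric.infDist (γ t) (range γ) < ε₀ := by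
      rwa [Metric.infDist_zero_of_mem (mem_range_self t)]
    change HasDerivAt γ (Z (γ t)) t
    rw [(hin₁ _ h0).2, perturbedField_eq_hamField (hlevel t)]
    exact hγ.hasDerivAt t
  have hderiv : ∀ F : E3 → ℝ, ContDiffOn ℝ ∞ F V → ∀ (f : ℝ) x, IsIntegralCurve x (fun _ => Z) →
      ∀ t, Metric.infDist (x t) (range γ) < ε₀ → HasDerivAt (fun t => F (x t) - f)
        (fderiv ℝ F (x t) (perturbedField ν H C h c α β (x t))) t := by
    intro F hF f x hx t ht
    have hFd : DifferentiableAt ℝ F (x t) :=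
      (hF.contDiffAt (hV.mem_nhds (hin₁ _ ht).1)).differentiableAt (by simp)
    have h1 := hx t
    simp only [(hin₁ _ ht).2] at h1
    exact (hFd.hasFDerivAt.comp_hasDerivAt t h1).sub_const f
  obtain ⟨μ₁, hμ₁, hμ₁'⟩ := hcomp.exists_forall_le'
    ((continuousOn_mul_norm_cross_gradient_sq hV hH hC hα.1).mono hε₂V)
    fun u hu => hind.mul_norm_cross_sq_pos hα.2 (hε₂V hu)
  have hdecayH : ∀ x, IsIntegralCurve x (fun _ => Z) → ∀ t, 0 ≤ t →
      (∀ r ∈ Icc 0 t, Metric.infDist (x r) (range γ) < ε₀) →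
        |H (x t) - h| ≤ Real.exp (-μ₁ * t) * |H (x 0) - h| := by
    intro x hx t ht hxr
    have hd : ∀ s ∈ Icc 0 t, HasDerivAt (fun t => H (x t) - h) _ s := fun s hs =>
      hderiv H hH h x hx s (hxr s hs)
    simp only [fderiv_left_perturbedField] at hd
    refine abs_le_exp_mul_of_hasDerivAt_mul_self (f := fun t => H (x t) - h) ht
      (fun s hs => (hd s hs).continuousAt.continuousWithinAt)
      (fun s hs => hd s (Ioo_subset_Icc_self hs)) fun s hs => ?_
    have := hμ₁' _ (hin₂ _ (hxr s (Ioo_subset_Icc_self hs)))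
    linarith
  have hdecayC : ∃ μ₂ > 0, ∀ x, IsIntegralCurve x (fun _ => Z) → x 0 ∈ S → ∀ t, 0 ≤ t →
      (∀ r ∈ Icc 0 t, Metric.infDist (x r) (range γ) < ε₀) →
        |C (x t) - c| ≤ Real.exp (-μ₂ * t) * |C (x 0) - c| := by
    have hd : ∀ x, IsIntegralCurve x (fun _ => Z) → ∀ t,
        (∀ r ∈ Icc 0 t, Metric.infDist (x r) (range γ) < ε₀) → ∀ s ∈ Icc 0 t,
          HasDerivAt (fun t => C (x t) - c) _ s := fun x hx t hxr s hs =>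
      hderiv C hC c x hx s (hxr s hs)
    simp only [fderiv_right_perturbedField] at hd
    rcases hβ with hβ | ⟨rfl, hS⟩
    · obtain ⟨μ₂, hμ₂, hμ₂'⟩ := hcomp.exists_forall_le'
        ((continuousOn_mul_norm_cross_gradient_sq hV hH hC hβ.1).mono hε₂V)
        fun u hu => hind.mul_norm_cross_sq_pos hβ.2 (hε₂V hu)
      refine ⟨μ₂, hμ₂, fun x hx _ t ht hxr => ?_⟩
      refine abs_le_exp_mul_of_hasDerivAt_mul_self (f := fun t => C (x t) - c) ht
        (fun s hs => (hd x hx t hxr s hs).continuousAt.continuousWithinAt)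
        (fun s hs => hd x hx t hxr s (Ioo_subset_Icc_self hs)) fun s hs => ?_
      have := hμ₂' _ (hin₂ _ (hxr s (Ioo_subset_Icc_self hs)))
      linarith
    · refine ⟨1, one_pos, fun x hx hxS t ht hxr => ?_⟩
      have h1 := abs_le_exp_mul_of_hasDerivAt_mul_self (f := fun t => C (x t) - c) (κ := 0) ht
        (fun s hs => (hd x hx t hxr s hs).continuousAt.continuousWithinAt)
        (fun s hs => hd x hx t hxr s (Ioo_subset_Icc_self hs)) (by simp)
      have h2 : C (x 0) = c := hS hxS
      simpa [h2] using h1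
  obtain ⟨μ₂, hμ₂, hdecayC⟩ := hdecayC
  obtain ⟨K, hK, ρ, hρ, hnear⟩ :=
    exists_forall_near_hamiltonianOrbit hV hν hH hC hind hγ hlevel
  have hcont : ∀ η > 0, ∃ δ > 0, ∀ u, Metric.infDist u (range γ) < δ →
      ‖(H u, C u) - (h, c)‖ < η := by
    intro η hη
    have hopen : IsOpen (V ∩ (fun u => ‖(H u, C u) - (h, c)‖) ⁻¹' Iio η) :=
      ((hH.continuousOn.prodMk hC.continuousOn).sub continuousOn_const).norm.isOpen_inter_preimage
        hV isOpen_Iio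
    obtain ⟨δ, hδ, hδ'⟩ := hΓ.exists_thickening_subset_open hopen (by
      rintro _ ⟨t, rfl⟩
      refine ⟨hγ.mem t, ?_⟩
      simpa [hlevel t] using hη)
    exact ⟨δ, hδ, fun u hu => (hδ' ((Metric.mem_thickening_iff_infDist_lt hne).2 hu)).2⟩
  have key : ∀ ε > 0, ∃ δ > 0, ∀ x₀ ∈ S, Metric.infDist x₀ (range γ) < δ →
      ∃ x : ℝ → E3, IsSolutionOn (perturbedField ν H C h c α β) V x (Ici 0) ∧ x 0 = x₀ ∧
        (∀ t > 0, Metric.infDist (x t) (range γ) < ε) ∧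
        ∃ θ₀ : ℝ, Tendsto (fun t => dist (x t) (γ (t + θ₀))) atTop (𝓝 0) := by
    intro ε hε
    obtain ⟨δ, hδ, hx⟩ := tendsto_dist_integralCurve_of_exp_decay hM hL hZγ
      (g := fun u => (H u, C u)) (z := (h, c)) (S := S) hK hρ hε₀pos (lt_min hμ₁ hμ₂) hnear hcont
      (fun x hx hxS t ht hxr => by
        have h1 := hdecayH x hx t ht hxr
        have h2 := hdecayC x hx hxS t ht hxr
        simp only [Prod.mk_sub_mk, Prod.norm_def, Real.norm_eq_abs]
        refine max_le (h1.trans ?_) (h2.trans ?_)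
        · gcongr
          exacts [min_le_left _ _, le_max_left _ _]
        · gcongr
          exacts [min_le_right _ _, le_max_right _ _]) (lt_min hε hε₀pos)
    refine ⟨δ, hδ, fun x₀ hx₀S hx₀ => ?_⟩
    obtain ⟨x, rfl, hxZ⟩ := exists_isIntegralCurve_of_lipschitzWith_of_bounded hM hL x₀
    obtain ⟨h1, h2⟩ := hx x hxZ hx₀S hx₀
    have h3 : ∀ t ∈ Ici (0 : ℝ), x t ∈ V ∧ Z (x t) = perturbedField ν H C h c α β (x t) :=
      fun t ht => hin₁ _ ((h1 t ht).trans_le (min_le_right _ _))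
    refine ⟨x, ⟨fun t ht => ?_, fun t ht => (h3 t ht).1⟩, rfl,
      fun t ht => (h1 t ht.le).trans_le (min_le_left _ _), h2⟩
    have h4 := hxZ t
    simp only [(h3 t ht).2] at h4
    exact h4.hasDerivWithinAt
  obtain ⟨δ, hδ, hx⟩ := key 1 one_pos
  refine ⟨⟨fun ε hε => ?_, δ, hδ, fun x₀ hx₀S hx₀ => ?_⟩, δ, hδ, fun x₀ hx₀S hx₀ => ?_⟩
  · obtain ⟨δ, hδ, hx⟩ := key ε hε
    refine ⟨δ, hδ, fun x₀ hx₀S hx₀ => ?_⟩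
    obtain ⟨x, h1, h2, h3, -⟩ := hx x₀ hx₀S hx₀
    exact ⟨x, h1, h2, h3⟩
  · obtain ⟨x, h1, h2, -, θ, h4⟩ := hx x₀ hx₀S hx₀
    exact ⟨x, h1, h2, squeeze_zero (fun _ => Metric.infDist_nonneg)
      (fun t => Metric.infDist_le_dist_of_mem (mem_range_self (t + θ))) h4⟩
  · obtain ⟨x, h1, h2, -, θ, h4⟩ := hx x₀ hx₀S hx₀
    exact ⟨θ, x, h1, h2, h4⟩

/-- Since `(H, C)` is a submersion at the orbit, all values close to `(h, c)` are attained
arbitrarily close to the orbit. -/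
theorem exists_infDist_lt_of_isRegularValue {U : Set E3} (hU : IsOpen U) {H C : E3 → ℝ}
    (hH : ContDiffOn ℝ ∞ H U) (hC : ContDiffOn ℝ ∞ C U) {γ : ℝ → E3} {h c : ℝ}
    (hγU : γ 0 ∈ U) (hlevel : H (γ 0) = h ∧ C (γ 0) = c)
    (hreg : IsRegularValue (fun u => (H u, C u)) U (h, c)) {O : Set E3} (hO : O ∈ 𝓝 (γ 0))
    {δ : ℝ} (hδ : 0 < δ) :
    ∀ᶠ y in 𝓝 (h, c), ∃ u ∈ O, Metric.infDist u (range γ) < δ ∧ (H u, C u) = y := by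
  have hd : HasStrictFDerivAt (fun u => (H u, C u)) (fderiv ℝ (fun u => (H u, C u)) (γ 0)) (γ 0) :=
    ((hH.prodMk hC).contDiffAt (hU.mem_nhds hγU)).hasStrictFDerivAt (by simp)
  have hsurj := hreg (γ 0) hγU (Prod.ext hlevel.1 hlevel.2)
  have hmap := hd.map_nhds_eq_of_surj (LinearMap.range_eq_top.2 hsurj)
  have hval : ((H (γ 0), C (γ 0)) : ℝ × ℝ) = (h, c) := Prod.ext hlevel.1 hlevel.2
  rw [hval] at hmap
  have hmem : (fun u => (H u, C u)) '' (O ∩ Metric.ball (γ 0) δ) ∈ 𝓝 (h, c) := by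
    rw [← hmap]
    exact image_mem_map (inter_mem hO (Metric.ball_mem_nhds _ hδ))
  filter_upwards [hmem] with y hy
  obtain ⟨u, ⟨huO, hu⟩, rfl⟩ := hy
  exact ⟨u, huO, (Metric.infDist_le_dist_of_mem (mem_range_self 0)).trans_lt hu, rfl⟩

end Stab3D

theorem theorem3p7 (U V : Set E3) (hU : IsOpen U) (hV : IsOpen V) (hVU : V ⊆ U)
    (H C ν : E3 → ℝ) (hH : ContDiffOn ℝ ∞ H U) (hC : ContDiffOn ℝ ∞ C U)
    (hν : ContDiffOn ℝ ∞ ν U) (hind : FunctionallyIndependentOn H C V)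
    (γ : ℝ → E3) (T : ℝ) (hγ : IsPeriodicOrbit (hamField ν H C) V γ T)
    (h c : ℝ) (hlevel : ∀ t, H (γ t) = h ∧ C (γ t) = c)
    (hreg : IsRegularValue (fun u => (H u, C u)) U (h, c)) :
    (IsRegularValue C U c → ∀ α : E3 → ℝ, IsSmoothPos V α →
      -- the stabilizing perturbation
      (IsFirstIntegral (hamField ν H C - hTerm H C h α) V C ∧
        IsInvariantSet (hamField ν H C - hTerm H C h α) V (V ∩ C ⁻¹' {c}) ∧
        IsPeriodicOrbit (hamField ν H C - hTerm H C h α) V γ T ∧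
        OrbitallyPhaseAsymptoticallyStable
          (hamField ν H C - hTerm H C h α) V (V ∩ C ⁻¹' {c}) γ) ∧
      -- the destabilizing perturbation
      (IsFirstIntegral (hamField ν H C + hTerm H C h α) V C ∧
        IsInvariantSet (hamField ν H C + hTerm H C h α) V (V ∩ C ⁻¹' {c}) ∧
        IsPeriodicOrbit (hamField ν H C + hTerm H C h α) V γ T ∧
        OrbitallyUnstable (hamField ν H C + hTerm H C h α) V V γ ∧
        OrbitallyUnstable (hamField ν H C + hTerm H C h α) V (V ∩ C ⁻¹' {c}) γ)) ∧
    (∀ α β : E3 → ℝ, IsSmoothPos V α → IsSmoothPos V β →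
      -- the stabilizing perturbation
      (IsPeriodicOrbit (hamField ν H C - hTerm H C h α + cTerm H C c β) V γ T ∧
        OrbitallyPhaseAsymptoticallyStable
          (hamField ν H C - hTerm H C h α + cTerm H C c β) V V γ) ∧
      -- the sign in front of `α` changed
      (IsPeriodicOrbit (hamField ν H C + hTerm H C h α + cTerm H C c β) V γ T ∧
        OrbitallyUnstable (hamField ν H C + hTerm H C h α + cTerm H C c β) V V γ) ∧
      -- the sign in front of `β` changed
      (IsPeriodicOrbit (hamField ν H C - hTerm H C h α - cTerm H C c β) V γ T ∧
        OrbitallyUnstable (hamField ν H C - hTerm H C h α - cTerm H C c β) V V γ) ∧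
      -- both signs changed
      (IsPeriodicOrbit (hamField ν H C + hTerm H C h α - cTerm H C c β) V γ T ∧
        OrbitallyUnstable (hamField ν H C + hTerm H C h α - cTerm H C c β) V V γ)) := by
  have hHV := hH.mono hVU
  have hCV := hC.mono hVU
  have hνV := hν.mono hVU
  have hFd : ∀ F : E3 → ℝ, ContDiffOn ℝ ∞ F V → ∀ u ∈ V, DifferentiableAt ℝ F u :=
    fun F hF u hu => (hF.contDiffAt (hV.mem_nhds hu)).differentiableAt (by simp)
  have hper : ∀ α β, IsPeriodicOrbit (perturbedField ν H C h c α β) V γ T := fun α β =>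
    hγ.congr fun t => perturbedField_eq_hamField (hlevel t)
  have hnearby : ∀ δ > 0, ∀ᶠ y in 𝓝 (h, c), ∃ u ∈ V, Metric.infDist u (range γ) < δ ∧
      (H u, C u) = y := fun δ hδ =>
    exists_infDist_lt_of_isRegularValue hU hH hC (hVU (hγ.mem 0)) (hlevel 0) hreg
      (hV.mem_nhds (hγ.mem 0)) hδ
  have hnearH : ∀ δ > 0, ∃ u ∈ V ∩ C ⁻¹' {c}, Metric.infDist u (range γ) < δ ∧ H u ≠ h := by
    intro δ hδ
    have hlim : Tendsto (fun r : ℝ => (r, c)) (𝓝[≠] h) (𝓝 (h, c)) :=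
      (Continuous.tendsto (by fun_prop) h).mono_left nhdsWithin_le_nhds
    obtain ⟨r, ⟨u, huV, hu, hur⟩, hr⟩ :=
      ((hlim.eventually (hnearby δ hδ)).and self_mem_nhdsWithin).exists
    rw [Prod.mk.injEq] at hur
    exact ⟨u, ⟨huV, hur.2⟩, hu, hur.1 ▸ hr⟩
  have hnearC : ∀ δ > 0, ∃ u ∈ V, Metric.infDist u (range γ) < δ ∧ C u ≠ c := by
    intro δ hδ
    have hlim : Tendsto (fun r : ℝ => (h, r)) (𝓝[≠] c) (𝓝 (h, c)) :=
      (Continuous.tendsto (by fun_prop) c).mono_left nhdsWithin_le_nhds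
    obtain ⟨r, ⟨u, huV, hu, hur⟩, hr⟩ :=
      ((hlim.eventually (hnearby δ hδ)).and self_mem_nhdsWithin).exists
    rw [Prod.mk.injEq] at hur
    exact ⟨u, huV, hu, hur.2 ▸ hr⟩
  have hunstableH : ∀ α β : E3 → ℝ, IsSmoothPos V α → ∀ S, V ∩ C ⁻¹' {c} ⊆ S →
      OrbitallyUnstable (perturbedField ν H C h c (-α) β) V S γ := by
    intro α β hα S hS
    refine (hper _ _).orbitallyUnstable hV (hFd H hHV)
      (continuousOn_mul_norm_cross_gradient_sq hV hHV hCV hα.1)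
      (fun u hu => hind.mul_norm_cross_sq_pos hα.2 hu) (f := h) (fun u _ => ?_) fun δ hδ => ?_
    · rw [fderiv_left_perturbedField, Pi.neg_apply, neg_neg]
    · obtain ⟨u, hu, h1, h2⟩ := hnearH δ hδ
      exact ⟨u, hS hu, h1, h2⟩
  have hunstableC : ∀ α β : E3 → ℝ, IsSmoothPos V β →
      OrbitallyUnstable (perturbedField ν H C h c α (-β)) V V γ := by
    intro α β hβ
    refine (hper _ _).orbitallyUnstable hV (hFd C hCV)
      (continuousOn_mul_norm_cross_gradient_sq hV hHV hCV hβ.1)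
      (fun u hu => hind.mul_norm_cross_sq_pos hβ.2 hu) (f := c) (fun u _ => ?_) hnearC
    rw [fderiv_right_perturbedField, Pi.neg_apply, neg_neg]
  have hfirst : ∀ α, IsFirstIntegral (perturbedField ν H C h c α 0) V C := fun α u _ => by
    rw [fderiv_right_perturbedField]
    simp
  have hinv : ∀ α, IsInvariantSet (perturbedField ν H C h c α 0) V (V ∩ C ⁻¹' {c}) := fun α =>
    isInvariantSet_perturbedField_zero hV hCV
  refine ⟨fun _ α hα => ?_, fun α β hα hβ => ?_⟩
  · rw [hamField_sub_hTerm ν H C h c, hamField_add_hTerm ν H C h c]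
    exact ⟨⟨hfirst _, hinv _, hper _ _, orbitallyPhaseAsymptoticallyStable_perturbedField hV hνV
        hHV hCV hind hγ hlevel hα (Or.inr ⟨rfl, inter_subset_right⟩)⟩,
      hfirst _, hinv _, hper _ _, hunstableH α 0 hα V inter_subset_left,
      hunstableH α 0 hα _ Subset.rfl⟩
  · rw [hamField_add_hTerm_add_cTerm, hamField_sub_hTerm_sub_cTerm, hamField_add_hTerm_sub_cTerm]
    exact ⟨⟨hper α β, orbitallyPhaseAsymptoticallyStable_perturbedField hV hνV hHV hCV hind hγ
        hlevel hα (Or.inl hβ)⟩,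
      ⟨hper _ _, hunstableH α β hα V inter_subset_left⟩, ⟨hper _ _, hunstableC α β hβ⟩,
      ⟨hper _ _, hunstableC (-α) β hβ⟩⟩
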